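/- Let $N>1$ be an integer. Let $S=\begin{pmatrix}0&-1\\1&0\end{pmatrix}$, $T=\begin{pmatrix}1&1\\0&1\end{pmatrix}$ in $SL_2(\mathbb Z)$, acting on the upper half plane $\mathbb H$ by Möbius transformations. For $j\in\mathbb Z$ let $W_j=\min\{m\in\mathbb Z_{>0} : mj-1\in(\mathbb Z/N)^*\}$ and $M_j=W_j-1$. Let $N_1=\lfloor (N-1)/2\rfloor$, $N_2=\lfloor N/2\rfloor$, $A=\{-N_1,\dots,N_2\}$, and $$\Theta=\{ST^i : i\in A\}\cup\{ST^jST^m : j\in A,\ \gcd(j,N)>1,\ 0\le m\le M_j\}.$$ Let $\overline D=\{z\in\mathbb H : |z|\ge 1,\ |\operatorname{Re}z|\le 1/2\}$, with edges $$L=\{z\in\mathbb H : \operatorname{Re}z=1/2,\ |z|\ge1\},\quad R=\{z\in\mathbb H : \operatorname{Re}z=-1/2,\ |z|\ge1\},\quad B=\{z\in\mathbb H : |z|=1,\ |\operatorname{Re}z|\le 1/2\},$$ and let $F=\bigcup_{\gamma\in\Theta}\gamma\overline D$ be the connected fundamental domain for $\Gamma_0(N)$ given by $\Theta$. Consider the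 following list of arcs: 1. $ST^{N_2}L$ and $ST^{-N_1}R$; 2. $ST^iB$ for each $i\in A$ with $\gcd(i,N)=1$; 3. for each $j\in A$ with $\gcd(j,N)>1$: (a) $ST^jSR$; (b) $ST^jST^{M_j}L$; (c) $ST^jST^mB$ for $1\le m\le M_j$. Then the topological boundary of $F$ in $\mathbb H$ is the union of the listed arcs. Moreover, the listed arcs are exactly the boundary arcs of $F$, i.e. exactly those sides $\gamma L$, $\gamma R$, $\gamma B$ $(\gamma\in\Theta)$ that are contained in the boundary of $F$. -/

import Mathlib

open scoped Pointwise MatrixGroups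

namespace LabelArcs

open ModularGroup

/-- `W_j`: the least positive integer `m` such that `m j - 1` is a unit modulo `N`
(for `N > 1` the integer `m = N` always qualifies). -/
noncomputable def W (N : ℕ) (j : ZMod N) : ℕ :=
  sInf {m : ℕ | 0 < m ∧ IsUnit ((m : ZMod N) * j - 1)}

/-- `M_j = W_j - 1`. -/
noncomputable def M (N : ℕ) (j : ZMod N) : ℕ := W N j - 1

/-- `N₁ = ⌊(N - 1) / 2⌋`. -/
def N₁ (N : ℕ) : ℤ := ((N : ℤ) - 1) / 2

/-- `N₂ = ⌊N / 2⌋`. -/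
def N₂ (N : ℕ) : ℤ := (N : ℤ) / 2

/-- The symmetric set `{-N₁, …, N₂}` of consecutive residue class representatives modulo `N`. -/
def A (N : ℕ) : Set ℤ := Set.Icc (-N₁ N) (N₂ N)

/-- The set of coset representatives
`{S T^i | i ∈ A} ∪ {S T^j S T^m | j ∈ A, gcd(j, N) > 1, 0 ≤ m ≤ M_j}`. -/
def Θ (N : ℕ) : Set SL(2, ℤ) :=
  {γ | ∃ i ∈ A N, γ = S * T ^ i} ∪
  {γ | ∃ j ∈ A N, 1 < Int.gcd j N ∧ ∃ m : ℕ, m ≤ M N (j : ZMod N) ∧ γ = S * T ^ j * S * T ^ m}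

/-- The left edge of the triangle (as seen from the cusp `∞`). -/
def L : Set UpperHalfPlane := {z | z.re = 1 / 2 ∧ 1 ≤ ‖(z : ℂ)‖}

/-- The right edge of the triangle (as seen from the cusp `∞`). -/
def R : Set UpperHalfPlane := {z | z.re = -(1 / 2) ∧ 1 ≤ ‖(z : ℂ)‖}

/-- The base of the triangle. -/
def B : Set UpperHalfPlane := {z | ‖(z : ℂ)‖ = 1 ∧ |z.re| ≤ 1 / 2}

/-- The fundamental domain given by `Θ`: the union of the translates `γ • fd`, `γ ∈ Θ`, where
`fd = {z ∈ ℍ | |z| ≥ 1, |Re z| ≤ 1/2}` is the standard closed ideal triangle. -/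
def domain (N : ℕ) : Set UpperHalfPlane := ⋃ γ ∈ Θ N, γ • fd

/-- The sides of the triangles which make up the domain. -/
def sides (N : ℕ) : Set (Set UpperHalfPlane) :=
  {C | ∃ γ ∈ Θ N, C = γ • L ∨ C = γ • R ∨ C = γ • B}

/-- The boundary arcs: the sides of the triangles of the domain that lie on its topological
boundary in the upper half plane. -/
def boundaryArcs (N : ℕ) : Set (Set UpperHalfPlane) :=
  {C | C ∈ sides N ∧ C ⊆ frontier (domain N)}

/-- The explicit list of arcs. -/
def listedArcs (N : ℕ) : Set (Set UpperHalfPlane) :=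
  {(S * T ^ N₂ N) • L, (S * T ^ (-N₁ N)) • R} ∪
  {C | ∃ i ∈ A N, Int.gcd i N = 1 ∧ C = (S * T ^ i) • B} ∪
  {C | ∃ j ∈ A N, 1 < Int.gcd j N ∧
    (C = (S * T ^ j * S) • R ∨
     C = (S * T ^ j * S * T ^ M N (j : ZMod N)) • L ∨
     ∃ m : ℕ, 1 ≤ m ∧ m ≤ M N (j : ZMod N) ∧ C = (S * T ^ j * S * T ^ m) • B)}

end LabelArcs

/-! The tiles `γ • fd`, where `γ` only matters up to sign, form a locally finite closed cover of
the upper half plane, and every neighbourhood of a point of a tile meets the interior of that tile.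
So a point lies in the interior of a union of tiles iff all the tiles through it belong to the
union. Any two tiles through a point are linked by crossing edges through that point. Hence a
frontier point lies on an edge which separates a tile of the union from a tile outside it; and
since every edge has a point which lies on its two adjacent tiles only, no other side is in the
frontier. The tiles across the three edges of `γ • fd` are those of `γ T`, `γ T⁻¹` and `γ S`, and
comparing matrix entries shows for which `γ ∈ Θ` they leave `Θ`. -/

namespace LabelArcs

open ModularGroup UpperHalfPlane

section Signs

/-- The elements of `SL(2, ℤ)` which agree up to sign with an element of `X`, i.e. the preimage of
the image of `X` in `PSL(2, ℤ)`. -/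
def signClosure (X : Set SL(2, ℤ)) : Set SL(2, ℤ) := X ∪ -X

variable {X : Set SL(2, ℤ)} {γ δ : SL(2, ℤ)}

lemma subset_signClosure : X ⊆ signClosure X := Set.subset_union_left

lemma neg_mem_signClosure : -γ ∈ signClosure X ↔ γ ∈ signClosure X := by
  simp [signClosure, or_comm]

lemma mem_signClosure_of_eq_or_eq_neg (hδ : δ ∈ signClosure X) (h : γ = δ ∨ γ = -δ) :
    γ ∈ signClosure X := by
  rcases h with rfl | rfl
  exacts [hδ, neg_mem_signClosure.mpr hδ]

lemma signClosure_subset {P : Set SL(2, ℤ)} (hneg : ∀ γ ∈ P, -γ ∈ P) (hX : X ⊆ P) :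
    signClosure X ⊆ P :=
  Set.union_subset hX fun γ hγ ↦ neg_neg γ ▸ hneg _ (hX hγ)

lemma signClosure_mono {Y : Set SL(2, ℤ)} (h : X ⊆ Y) : signClosure X ⊆ signClosure Y :=
  Set.union_subset_union h (Set.neg_subset_neg.mpr h)

lemma neg_smul_set (γ : SL(2, ℤ)) (s : Set ℍ) : (-γ) • s = γ • s :=
  Set.image_congr fun z _ ↦ SL_neg_smul γ z

end Signs

section LocalFiniteness

lemma im_smul_le_max (γ : SL(2, ℤ)) (z : ℍ) : (γ • z).im ≤ max z.im (1 / z.im) := by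
  rw [ModularGroup.im_smul_eq_div_normSq]
  by_cases hc : γ 1 0 = 0
  · have hd : γ 1 1 = 1 ∨ γ 1 1 = -1 := by
      simpa [hc, isCoprime_zero_left, Int.isUnit_iff] using bottom_row_coprime γ
    rcases hd with hd | hd <;> simp [denom_apply, hc, hd]
  · have hc' : (1 : ℝ) ≤ (γ 1 0 : ℝ) ^ 2 := by
      exact_mod_cast (one_le_sq_iff_one_le_abs _).mpr (Int.one_le_abs hc)
    have hdenom : z.im ^ 2 ≤ Complex.normSq (denom γ z) :=
      calc z.im ^ 2 ≤ ((γ 1 0 : ℝ) * z.im) ^ 2 := by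
            rw [mul_pow]
            exact le_mul_of_one_le_left (by positivity) hc'
        _ ≤ Complex.normSq (denom γ z) := by
            simpa using z.c_mul_im_sq_le_normSq_denom (γ : GL (Fin 2) ℝ)
    calc z.im / Complex.normSq (denom γ z) ≤ z.im / z.im ^ 2 := by gcongr
      _ = 1 / z.im := by field_simp
      _ ≤ _ := le_max_right _ _

instance : ContinuousConstSMul SL(2, ℤ) ℍ where
  continuous_const_smul γ := by
    simp only [sl_moeb]
    exact continuous_const_smul _

lemma finite_setOf_smul_inter_nonempty {K K' : Set ℍ} (hK : IsCompact K) (hK' : IsCompact K') :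
    {γ : SL(2, ℤ) | (γ • K ∩ K').Nonempty}.Finite := by
  let toRange : SL(2, ℤ) → 𝒮ℒ := fun γ ↦ ⟨Matrix.SpecialLinearGroup.mapGL ℝ γ, γ, rfl⟩
  have hinj : Function.Injective toRange := fun γ γ' h ↦
    Matrix.SpecialLinearGroup.mapGL_injective (Subtype.ext_iff.mp h)
  have hfin := ProperlyDiscontinuousSMul.finite_disjoint_inter_image (Γ := 𝒮ℒ) hK hK'
  exact (hfin.preimage hinj.injOn).subset fun _ hγ ↦ hγ

theorem locallyFinite_smul_fd : LocallyFinite fun γ : SL(2, ℤ) ↦ γ • fd := by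
  intro z
  obtain ⟨K, hK, hz⟩ := exists_compact_mem_nhds z
  obtain ⟨y, hy⟩ : BddAbove ((fun w : ℍ ↦ max w.im (1 / w.im)) '' K) :=
    hK.bddAbove_image (continuous_im.max
      (continuous_const.div continuous_im fun w ↦ w.im_ne_zero)).continuousOn
  refine ⟨K, hz, ((finite_setOf_smul_inter_nonempty hK
    (isCompact_truncatedFundamentalDomain y)).preimage inv_injective.injOn).subset ?_⟩
  rintro γ ⟨w, hw, hwK⟩
  exact ⟨γ⁻¹ • w, Set.smul_mem_smul_set hwK, Set.mem_smul_set_iff_inv_smul_mem.mp hw,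
    (im_smul_le_max _ _).trans (hy ⟨w, hwK, rfl⟩)⟩

end LocalFiniteness

section Tiles

variable {X : Set SL(2, ℤ)} {z : ℍ}

lemma mem_smul_fd_iff : z ∈ X • fd ↔ ∃ γ ∈ X, z ∈ γ • fd := by
  rw [← Set.iUnion_smul_set]
  exact Set.mem_iUnion₂.trans (by simp only [exists_prop])

lemma signClosure_smul (X : Set SL(2, ℤ)) (s : Set ℍ) : signClosure X • s = X • s := by
  have hneg : -X • s = X • s := by
    rw [← Set.image_neg_eq_neg, ← Set.iUnion_smul_set, Set.biUnion_image]
    simp only [neg_smul_set, Set.iUnion_smul_set]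
  rw [signClosure, Set.union_smul, hneg, Set.union_self]

lemma isClosed_smul_fd (X : Set SL(2, ℤ)) : IsClosed (X • fd) := by
  rw [← Set.iUnion_smul_set, Set.biUnion_eq_iUnion]
  exact (locallyFinite_smul_fd.comp_injective Subtype.val_injective).isClosed_iUnion
    fun γ ↦ isClosed_fd.smul γ.1

lemma mem_signClosure_of_mem_interior (hz : z ∈ interior (X • fd)) {γ : SL(2, ℤ)}
    (hγ : z ∈ γ • fd) : γ ∈ signClosure X := by
  obtain ⟨w, hw, hwγ⟩ : (interior (X • fd) ∩ γ • fdo).Nonempty := by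
    rw [fd_eq_closure_fdo, ← closure_smul] at hγ
    exact mem_closure_iff.mp hγ _ isOpen_interior hz
  obtain ⟨γ', hγ', hwγ'⟩ := mem_smul_fd_iff.mp (interior_subset hw)
  have hone : γ'⁻¹ * γ = 1 ∨ γ'⁻¹ * γ = -1 := by
    refine eq_one_or_neg_one_of_mem_fdo_mem_fd (z := γ⁻¹ • w)
      (Set.mem_smul_set_iff_inv_smul_mem.mp hwγ) ?_
    rwa [mul_smul, smul_inv_smul, ← Set.mem_smul_set_iff_inv_smul_mem]
  refine mem_signClosure_of_eq_or_eq_neg (subset_signClosure hγ') ?_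
  simpa only [inv_mul_eq_iff_eq_mul, mul_one, mul_neg_one] using hone

theorem mem_interior_smul_fd_iff :
    z ∈ interior (X • fd) ↔ ∀ γ : SL(2, ℤ), z ∈ γ • fd → γ ∈ signClosure X := by
  refine ⟨fun hz γ ↦ mem_signClosure_of_mem_interior hz, fun h ↦ ?_⟩
  rw [mem_interior_iff_mem_nhds, ← signClosure_smul]
  filter_upwards [locallyFinite_smul_fd.iInter_compl_mem_nhds (fun γ ↦ isClosed_fd.smul γ) z]
    with w hw
  obtain ⟨g, hg⟩ := exists_smul_mem_fd w
  have hwg : w ∈ g⁻¹ • fd := by rwa [Set.mem_smul_set_iff_inv_smul_mem, inv_inv]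
  have hzg : z ∈ g⁻¹ • fd := by
    by_contra hz
    exact Set.mem_iInter₂.mp hw g⁻¹ hz hwg
  exact mem_smul_fd_iff.mpr ⟨g⁻¹, h _ hzg, hwg⟩

theorem mem_frontier_smul_fd_iff :
    z ∈ frontier (X • fd) ↔
      (∃ γ ∈ X, z ∈ γ • fd) ∧ ∃ γ : SL(2, ℤ), z ∈ γ • fd ∧ γ ∉ signClosure X := by
  rw [(isClosed_smul_fd X).frontier_eq, Set.mem_sdiff, mem_smul_fd_iff, mem_interior_smul_fd_iff]
  push Not
  rfl

end Tiles

section Edges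

lemma mem_fd_iff {z : ℍ} : z ∈ fd ↔ 1 ≤ ‖(z : ℂ)‖ ∧ |z.re| ≤ 1 / 2 :=
  and_congr_left' Complex.one_le_normSq_iff

lemma re_S_smul (z : ℍ) : (S • z).re = -z.re / ‖(z : ℂ)‖ ^ 2 := by
  rw [modular_S_smul, ← coe_re, coe_mk, Complex.inv_re, Complex.normSq_neg,
    Complex.normSq_eq_norm_sq, Complex.neg_re, coe_re]

lemma norm_S_smul (z : ℍ) : ‖((S • z : ℍ) : ℂ)‖ = ‖(z : ℂ)‖⁻¹ := by
  rw [modular_S_smul, coe_mk, norm_inv, norm_neg]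

lemma T_smul_R : T • R = L := by
  ext z
  have hre : (T⁻¹ • z).re = -(1 / 2) ↔ z.re = 1 / 2 := by
    rw [re_T_inv_smul]
    constructor <;> intro h <;> linarith
  have hnorm (h : z.re = 1 / 2) : ‖((T⁻¹ • z : ℍ) : ℂ)‖ = ‖(z : ℂ)‖ := by
    simp only [Complex.norm_def, Complex.normSq_apply, coe_re, coe_im, re_T_inv_smul,
      im_T_inv_smul, h]
    norm_num
  simp only [Set.mem_smul_set_iff_inv_smul_mem, R, L, Set.mem_ofPred_eq, hre]
  exact and_congr_right fun h ↦ by rw [hnorm h]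

lemma S_smul_B : S • B = B := by
  ext z
  simp only [Set.mem_smul_set_iff_inv_smul_mem, S_inv, SL_neg_smul, B, Set.mem_ofPred_eq,
    norm_S_smul, inv_eq_one, re_S_smul]
  exact and_congr_right fun h ↦ by rw [h, one_pow, div_one, abs_neg]

/-- The three edges of the standard triangle `fd`. -/
inductive Edge
  | left
  | right
  | base

namespace Edge

/-- The point set of an edge of `fd`. -/
def arc : Edge → Set ℍ
  | left => L
  | right => R
  | base => B

/-- The element `g` for which `g • fd` is the tile on the other side of an edge of `fd`; across the
corresponding edge of `γ • fd` lies `(γ * g) • fd`. -/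
def crossing : Edge → SL(2, ℤ)
  | left => T
  | right => T⁻¹
  | base => S

lemma exists_iff {p : Edge → Prop} : (∃ e, p e) ↔ p left ∨ p right ∨ p base :=
  ⟨fun ⟨e, he⟩ ↦ by cases e <;> tauto, by rintro (h | h | h) <;> exact ⟨_, h⟩⟩

lemma arc_subset_fd (e : Edge) : e.arc ⊆ fd := by
  rcases e with _ | _ | _ <;> intro z hz <;> rw [mem_fd_iff]
  · exact ⟨hz.2, by rw [hz.1]; norm_num⟩
  · exact ⟨hz.2, by rw [hz.1]; norm_num⟩
  · exact ⟨hz.1.ge, hz.2⟩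

lemma arc_subset_crossing_smul_fd (e : Edge) : e.arc ⊆ e.crossing • fd := by
  rcases e with _ | _ | _
  · exact T_smul_R.ge.trans (Set.smul_set_mono right.arc_subset_fd)
  · rw [Set.subset_smul_set_iff, crossing, inv_inv]
    exact T_smul_R.le.trans left.arc_subset_fd
  · exact S_smul_B.ge.trans (Set.smul_set_mono base.arc_subset_fd)

lemma exists_mem_arc_forall_eq (e : Edge) : ∃ z ∈ e.arc, ∀ e' : Edge, z ∈ e'.arc → e' = e := by
  have one_lt_norm {z : ℍ} (hz : z.im = 2) : 1 < ‖(z : ℂ)‖ :=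
    calc (1 : ℝ) < |(z : ℂ).im| := by rw [coe_im, hz]; norm_num
      _ ≤ ‖(z : ℂ)‖ := Complex.abs_im_le_norm _
  rcases e with _ | _ | _
  · have hnorm := one_lt_norm (z := ⟨⟨1 / 2, 2⟩, two_pos⟩) rfl
    refine ⟨_, ⟨rfl, hnorm.le⟩, ?_⟩
    rintro (_ | _ | _) ⟨h, -⟩
    · rfl
    · norm_num [← coe_re] at h
    · exact absurd h hnorm.ne'
  · have hnorm := one_lt_norm (z := ⟨⟨-(1 / 2), 2⟩, two_pos⟩) rfl
    refine ⟨_, ⟨rfl, hnorm.le⟩, ?_⟩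
    rintro (_ | _ | _) ⟨h, -⟩
    · norm_num [← coe_re] at h
    · rfl
    · exact absurd h hnorm.ne'
  · refine ⟨I, ⟨by simp, by simp⟩, ?_⟩
    rintro (_ | _ | _) ⟨h, -⟩
    · norm_num at h
    · norm_num at h
    · rfl

end Edge

lemma ρ_mem_R : ρ ∈ R := ⟨by norm_num [ρ], norm_ρ.ge⟩

lemma ρ_mem_B : ρ ∈ B := ⟨norm_ρ, by norm_num [ρ]⟩

lemma S_smul_ρ : S • ρ = T • ρ := by
  rw [modular_T_smul, modular_S_smul, UpperHalfPlane.ext_iff]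
  norm_num [ρ, Complex.ext_iff, Complex.normSq, ← pow_two, div_pow]

lemma T_smul_ρ_mem_L : T • ρ ∈ L := T_smul_R ▸ Set.smul_mem_smul_set ρ_mem_R

lemma T_smul_ρ_mem_B : T • ρ ∈ B :=
  S_smul_ρ ▸ S_smul_B ▸ Set.smul_mem_smul_set ρ_mem_B

theorem mem_signClosure_of_mem_smul_fd {z : ℍ} (hz : z ∈ fd) {g : SL(2, ℤ)} (hg : z ∈ g • fd) :
    g ∈ signClosure {1} ∨ (∃ e : Edge, z ∈ e.arc ∧ g ∈ signClosure {e.crossing}) ∨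
      (z = ρ ∧ g ∈ signClosure {T⁻¹ * S, T⁻¹ * S * T⁻¹, S * T}) ∨
      (z = T • ρ ∧ g ∈ signClosure {T * S, T * S * T, S * T⁻¹}) := by
  obtain ⟨hnorm, hre⟩ := mem_fd_iff.mp hz
  have inv_mem {h : SL(2, ℤ)} {Y : Set SL(2, ℤ)} (hY : h⁻¹ ∈ signClosure Y)
      (hh : g⁻¹ = h ∨ g⁻¹ = -h) : g ∈ signClosure Y := by
    refine mem_signClosure_of_eq_or_eq_neg hY ?_
    rcases hh with hh | hh
    · exact Or.inl (inv_eq_iff_eq_inv.mp hh)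
    · refine Or.inr ?_
      rw [inv_eq_iff_eq_inv.mp hh, inv_neg]
  rw [Set.mem_smul_set_iff_inv_smul_mem] at hg
  rcases cases_of_mem_fd_smul_mem_fd hz hg with
    h | ⟨h, hw⟩ | ⟨h, hw⟩ | ⟨h, hw⟩ | ⟨h, hw⟩ | ⟨h, hw⟩ | ⟨h, hw⟩ | ⟨h, hw⟩ | ⟨h, hw⟩ | ⟨h, hw⟩
  · exact Or.inl (inv_mem (by simp [signClosure]) h)
  · refine Or.inr (Or.inl ⟨.right, ⟨by rw [hw]; ring, hnorm⟩, inv_mem ?_ h⟩)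
    simp [signClosure, Edge.crossing]
  · refine Or.inr (Or.inl ⟨.left, ⟨hw, hnorm⟩, inv_mem ?_ h⟩)
    simp [signClosure, Edge.crossing]
  · refine Or.inr (Or.inl ⟨.base, ⟨hw, hre⟩, inv_mem ?_ h⟩)
    simp [signClosure, Edge.crossing, S_inv]
  iterate 3
    refine Or.inr (Or.inr (Or.inr ⟨hw.trans (modular_T_smul ρ).symm, inv_mem ?_ h⟩))
    simp [signClosure, mul_assoc, S_inv]
  iterate 3
    refine Or.inr (Or.inr (Or.inl ⟨hw, inv_mem ?_ h⟩))
    simp [signClosure, mul_assoc, S_inv]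

end Edges

section OuterSides

/-- The sides of the tiles indexed by `X` across which lies a tile not indexed by `X`. -/
def outerSides (X : Set SL(2, ℤ)) : Set (Set ℍ) :=
  {C | ∃ γ ∈ X, ∃ e : Edge, γ * e.crossing ∉ signClosure X ∧ C = γ • e.arc}

variable {P X : Set SL(2, ℤ)} {z : ℍ}

lemma mem_of_forall_crossing_mem_of_mem_fd (hneg : ∀ γ ∈ P, -γ ∈ P)
    (hcross : ∀ γ ∈ P, ∀ e : Edge, γ⁻¹ • z ∈ e.arc → γ * e.crossing ∈ P)
    (hone : 1 ∈ P) (hz : z ∈ fd) {g : SL(2, ℤ)} (hg : z ∈ g • fd) : g ∈ P := by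
  let atVertex (w : ℍ) : Set SL(2, ℤ) := {γ ∈ P | γ⁻¹ • z = w}
  have cross {w : ℍ} {γ : SL(2, ℤ)} (hγ : γ ∈ atVertex w) (e : Edge) (hw : w ∈ e.arc) :
      γ * e.crossing ∈ atVertex (e.crossing⁻¹ • w) :=
    ⟨hcross γ hγ.1 e (hγ.2 ▸ hw), by rw [mul_inv_rev, mul_smul, hγ.2]⟩
  have crossR {γ : SL(2, ℤ)} (hγ : γ ∈ atVertex ρ) : γ * T⁻¹ ∈ atVertex (T • ρ) :=
    inv_inv T ▸ cross hγ .right ρ_mem_R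
  have crossL {γ : SL(2, ℤ)} (hγ : γ ∈ atVertex (T • ρ)) : γ * T ∈ atVertex ρ :=
    inv_smul_smul T ρ ▸ cross hγ .left T_smul_ρ_mem_L
  have crossB {γ : SL(2, ℤ)} (hγ : γ ∈ atVertex ρ) : γ * S ∈ atVertex (T • ρ) := by
    rw [← S_smul_ρ, ← SL_neg_smul, ← S_inv]
    exact cross hγ .base ρ_mem_B
  have crossB' {γ : SL(2, ℤ)} (hγ : γ ∈ atVertex (T • ρ)) : γ * S ∈ atVertex ρ := by
    rw [← inv_smul_smul S ρ, S_smul_ρ]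
    exact cross hγ .base T_smul_ρ_mem_B
  rcases mem_signClosure_of_mem_smul_fd hz hg with h | ⟨e, he, h⟩ | ⟨rfl, h⟩ | ⟨rfl, h⟩ <;>
    refine signClosure_subset hneg ?_ h
  · exact Set.singleton_subset_iff.mpr hone
  · exact Set.singleton_subset_iff.mpr (one_mul e.crossing ▸
      hcross 1 hone e (by rwa [inv_one, one_smul]))
  · have h₁ : 1 ∈ atVertex ρ := ⟨hone, by rw [inv_one, one_smul]⟩
    have hR := crossB' (crossR h₁)
    have hB := crossL (crossB h₁)
    rw [one_mul] at hR hB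
    rintro _ (rfl | rfl | rfl)
    exacts [hR.1, (crossR hR).1, hB.1]
  · have h₁ : 1 ∈ atVertex (T • ρ) := ⟨hone, by rw [inv_one, one_smul]⟩
    have hL := crossB (crossL h₁)
    have hB := crossR (crossB' h₁)
    rw [one_mul] at hL hB
    rintro _ (rfl | rfl | rfl)
    exacts [hL.1, (crossL hL).1, hB.1]

/-- Any two tiles through a point are joined by a chain of tiles through that point in which
neighbours share an edge containing the point. -/
theorem mem_of_forall_crossing_mem (hneg : ∀ γ ∈ P, -γ ∈ P)
    (hcross : ∀ γ ∈ P, ∀ e : Edge, γ⁻¹ • z ∈ e.arc → γ * e.crossing ∈ P)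
    {γ₀ γ : SL(2, ℤ)} (hγ₀ : γ₀ ∈ P) (hz₀ : z ∈ γ₀ • fd) (hz : z ∈ γ • fd) : γ ∈ P := by
  suffices γ₀⁻¹ * γ ∈ {g | γ₀ * g ∈ P} by
    rwa [Set.mem_ofPred_eq, mul_inv_cancel_left] at this
  refine mem_of_forall_crossing_mem_of_mem_fd (z := γ₀⁻¹ • z) ?_ ?_ ?_
    (Set.mem_smul_set_iff_inv_smul_mem.mp hz₀) ?_
  · intro g hg
    rw [Set.mem_ofPred_eq, mul_neg]
    exact hneg _ hg
  · intro g hg e he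
    rw [Set.mem_ofPred_eq, ← mul_assoc]
    exact hcross _ hg e (by rwa [mul_inv_rev, mul_smul])
  · rwa [Set.mem_ofPred_eq, mul_one]
  · rw [mul_smul]
    exact Set.smul_mem_smul_set hz

theorem frontier_smul_fd (X : Set SL(2, ℤ)) : frontier (X • fd) = ⋃₀ outerSides X := by
  ext z
  rw [mem_frontier_smul_fd_iff]
  constructor
  · rintro ⟨⟨γ₀, hγ₀, hz₀⟩, γ, hz, hγ⟩
    by_contra hout
    refine hγ (mem_of_forall_crossing_mem (fun _ ↦ neg_mem_signClosure.mpr) ?_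
      (subset_signClosure hγ₀) hz₀ hz)
    have cross : ∀ δ ∈ X, ∀ e : Edge, δ⁻¹ • z ∈ e.arc → δ * e.crossing ∈ signClosure X := by
      intro δ hδ e he
      by_contra hδe
      exact hout ⟨_, ⟨δ, hδ, e, hδe, rfl⟩, Set.mem_smul_set_iff_inv_smul_mem.mpr he⟩
    rintro δ (hδ | hδ) e he
    · exact cross δ hδ e he
    · rw [← neg_mem_signClosure, ← neg_mul]
      exact cross (-δ) hδ e (by rwa [inv_neg, SL_neg_smul])
  · rintro ⟨_, ⟨γ, hγ, e, hγe, rfl⟩, hz⟩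
    refine ⟨⟨γ, hγ, Set.smul_set_mono e.arc_subset_fd hz⟩, γ * e.crossing, ?_, hγe⟩
    rw [mul_smul]
    exact Set.smul_set_mono e.arc_subset_crossing_smul_fd hz

lemma Edge.exists_mem_arc_forall_mem_signClosure (e : Edge) :
    ∃ z ∈ e.arc, ∀ g : SL(2, ℤ), z ∈ g • fd → g ∈ signClosure {1, e.crossing} := by
  obtain ⟨z, hz, hunique⟩ := e.exists_mem_arc_forall_eq
  refine ⟨z, hz, fun g hg ↦ ?_⟩
  rcases mem_signClosure_of_mem_smul_fd (e.arc_subset_fd hz) hg with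
    h | ⟨e', he', h⟩ | ⟨rfl, -⟩ | ⟨rfl, -⟩
  · exact signClosure_mono (by simp) h
  · rw [hunique e' he'] at h
    exact signClosure_mono (by simp) h
  · cases (hunique .right ρ_mem_R).trans (hunique .base ρ_mem_B).symm
  · cases (hunique .left T_smul_ρ_mem_L).trans (hunique .base T_smul_ρ_mem_B).symm

theorem outerSides_eq (X : Set SL(2, ℤ)) :
    outerSides X =
      {C | (∃ γ ∈ X, ∃ e : Edge, C = γ • e.arc) ∧ C ⊆ frontier (X • fd)} := by
  ext C
  constructor
  · rintro ⟨γ, hγ, e, he, rfl⟩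
    refine ⟨⟨γ, hγ, e, rfl⟩, ?_⟩
    rw [frontier_smul_fd]
    exact Set.subset_sUnion_of_mem ⟨γ, hγ, e, he, rfl⟩
  · rintro ⟨⟨γ, hγ, e, rfl⟩, hfr⟩
    refine ⟨γ, hγ, e, fun hcross ↦ ?_, rfl⟩
    obtain ⟨z, hz, htiles⟩ := e.exists_mem_arc_forall_mem_signClosure
    obtain ⟨-, δ, hzδ, hδ⟩ := mem_frontier_smul_fd_iff.mp (hfr (Set.smul_mem_smul_set hz))
    have hsub : signClosure {1, e.crossing} ⊆ {g | γ * g ∈ signClosure X} := by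
      refine signClosure_subset (fun g hg ↦ ?_) (Set.pair_subset ?_ hcross)
      · rwa [Set.mem_ofPred_eq, mul_neg, neg_mem_signClosure]
      · rw [Set.mem_ofPred_eq, mul_one]
        exact subset_signClosure hγ
    refine hδ (mul_inv_cancel_left γ δ ▸ hsub (htiles _ ?_))
    rwa [mul_smul, Set.mem_smul_set_iff_inv_smul_mem, inv_inv]

end OuterSides

section Fans

/-- The elements `S T ^ i` for `i ∈ [a, b]`, whose tiles are the consecutive triangles with a
vertex at the cusp `0`, together with, for every `j ∈ J`, the elements `S T ^ j S T ^ m` for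
`0 ≤ m ≤ M j`, whose tiles are consecutive triangles beyond the base of the tile of `S T ^ j`. -/
def fan (a b : ℤ) (J : Set ℤ) (M : ℤ → ℕ) : Set SL(2, ℤ) :=
  {γ | ∃ i ∈ Set.Icc a b, γ = S * T ^ i} ∪
  {γ | ∃ j ∈ J, ∃ m : ℕ, m ≤ M j ∧ γ = S * T ^ j * S * T ^ m}

/-- The list of arcs bounding the tiles of `fan a b J M`, for `J ⊆ [a, b]`. -/
def fanArcs (a b : ℤ) (J : Set ℤ) (M : ℤ → ℕ) : Set (Set ℍ) :=
  {(S * T ^ b) • L, (S * T ^ a) • R} ∪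
  {C | ∃ i ∈ Set.Icc a b, i ∉ J ∧ C = (S * T ^ i) • B} ∪
  {C | ∃ j ∈ J,
    (C = (S * T ^ j * S) • R ∨
     C = (S * T ^ j * S * T ^ M j) • L ∨
     ∃ m : ℕ, 1 ≤ m ∧ m ≤ M j ∧ C = (S * T ^ j * S * T ^ m) • B)}

lemma coe_S_mul_T_zpow (i : ℤ) :
    ((S * T ^ i : SL(2, ℤ)) : Matrix (Fin 2) (Fin 2) ℤ) = !![0, -1; 1, i] := by
  simp [coe_S, coe_T_zpow]

lemma coe_S_mul_T_zpow_mul_S_mul_T_zpow (j m : ℤ) :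
    ((S * T ^ j * S * T ^ m : SL(2, ℤ)) : Matrix (Fin 2) (Fin 2) ℤ) =
      !![-1, -m; j, j * m - 1] := by
  rw [mul_assoc, Matrix.SpecialLinearGroup.coe_mul, coe_S_mul_T_zpow, coe_S_mul_T_zpow,
    Matrix.mul_fin_two]
  congrm !![?_, ?_; ?_, ?_] <;> ring

lemma coe_S_mul_T_zpow_mul_S_mul_T_zpow_mul_S (j m : ℤ) :
    ((S * T ^ j * S * T ^ m * S : SL(2, ℤ)) : Matrix (Fin 2) (Fin 2) ℤ) =
      !![-m, 1; j * m - 1, -j] := by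
  rw [Matrix.SpecialLinearGroup.coe_mul, coe_S_mul_T_zpow_mul_S_mul_T_zpow, coe_S]
  simp

variable {a b : ℤ} {J : Set ℤ} {M : ℤ → ℕ} {i j m : ℤ}

lemma S_mul_T_zpow_mem_fan (hi : i ∈ Set.Icc a b) : S * T ^ i ∈ fan a b J M :=
  Or.inl ⟨i, hi, rfl⟩

lemma S_mul_T_zpow_mul_S_mul_T_zpow_mem_fan (hj : j ∈ J) (hm : m ∈ Set.Icc 0 (M j : ℤ)) :
    S * T ^ j * S * T ^ m ∈ fan a b J M := by
  lift m to ℕ using hm.1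
  exact Or.inr ⟨j, hj, m, by exact_mod_cast hm.2, by rw [zpow_natCast]⟩

/-- Products of two entries do not see the sign of `γ`, and they recover `i`, `j` and `m`. -/
lemma signClosure_fan_subset :
    signClosure (fan a b J M) ⊆
      {γ | (γ 0 0 = 0 ∧ -(γ 0 1 * γ 1 1) ∈ Set.Icc a b) ∨
        (γ 0 0 ^ 2 = 1 ∧ -(γ 0 0 * γ 1 0) ∈ J ∧
          γ 0 0 * γ 0 1 ∈ Set.Icc 0 (M (-(γ 0 0 * γ 1 0)) : ℤ))} := by
  refine signClosure_subset (fun γ hγ ↦ by simpa [neg_eq_iff_eq_neg, or_comm] using hγ) ?_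
  rintro _ (⟨i, hi, rfl⟩ | ⟨j, hj, m, hm, rfl⟩)
  · left
    simpa [coe_S_mul_T_zpow, -Matrix.SpecialLinearGroup.coe_mul] using hi
  · right
    simp [← zpow_natCast, coe_S_mul_T_zpow_mul_S_mul_T_zpow,
      -Matrix.SpecialLinearGroup.coe_mul, hj, hm]

lemma S_mul_T_zpow_mem_signClosure_fan_iff :
    S * T ^ i ∈ signClosure (fan a b J M) ↔ i ∈ Set.Icc a b := by
  refine ⟨fun h ↦ ?_, fun h ↦ subset_signClosure (S_mul_T_zpow_mem_fan h)⟩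
  simpa [coe_S_mul_T_zpow, -Matrix.SpecialLinearGroup.coe_mul] using
    signClosure_fan_subset h

lemma S_mul_T_zpow_mul_S_mul_T_zpow_mem_signClosure_fan_iff :
    S * T ^ j * S * T ^ m ∈ signClosure (fan a b J M) ↔ j ∈ J ∧ m ∈ Set.Icc 0 (M j : ℤ) := by
  refine ⟨fun h ↦ ?_, fun ⟨hj, hm⟩ ↦
    subset_signClosure (S_mul_T_zpow_mul_S_mul_T_zpow_mem_fan hj hm)⟩
  simpa [coe_S_mul_T_zpow_mul_S_mul_T_zpow, -Matrix.SpecialLinearGroup.coe_mul] using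
    signClosure_fan_subset h

lemma S_mul_T_zpow_mul_T_mem_signClosure_fan_iff (hi : i ∈ Set.Icc a b) :
    S * T ^ i * T ∈ signClosure (fan a b J M) ↔ i ≠ b := by
  rw [mul_assoc, ← zpow_add_one, S_mul_T_zpow_mem_signClosure_fan_iff]
  grind

lemma S_mul_T_zpow_mul_T_inv_mem_signClosure_fan_iff (hi : i ∈ Set.Icc a b) :
    S * T ^ i * T⁻¹ ∈ signClosure (fan a b J M) ↔ i ≠ a := by
  rw [mul_assoc, ← zpow_sub_one, S_mul_T_zpow_mem_signClosure_fan_iff]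
  grind

lemma S_mul_T_zpow_mul_S_mem_signClosure_fan_iff :
    S * T ^ j * S ∈ signClosure (fan a b J M) ↔ j ∈ J := by
  simpa using S_mul_T_zpow_mul_S_mul_T_zpow_mem_signClosure_fan_iff (j := j) (m := 0)

lemma S_mul_T_zpow_mul_S_mul_T_zpow_mul_T_mem_signClosure_fan_iff (hj : j ∈ J)
    (hm : m ∈ Set.Icc 0 (M j : ℤ)) :
    S * T ^ j * S * T ^ m * T ∈ signClosure (fan a b J M) ↔ m ≠ M j := by
  rw [mul_assoc _ (T ^ m), ← zpow_add_one,
    S_mul_T_zpow_mul_S_mul_T_zpow_mem_signClosure_fan_iff]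
  grind

lemma S_mul_T_zpow_mul_S_mul_T_zpow_mul_T_inv_mem_signClosure_fan_iff (hj : j ∈ J)
    (hm : m ∈ Set.Icc 0 (M j : ℤ)) :
    S * T ^ j * S * T ^ m * T⁻¹ ∈ signClosure (fan a b J M) ↔ m ≠ 0 := by
  rw [mul_assoc _ (T ^ m), ← zpow_sub_one,
    S_mul_T_zpow_mul_S_mul_T_zpow_mem_signClosure_fan_iff]
  grind

lemma S_mul_T_zpow_mul_S_mul_T_zpow_mul_S_mem_signClosure_fan_iff (hj : j ∈ Set.Icc a b)
    (hm : 0 ≤ m) : S * T ^ j * S * T ^ m * S ∈ signClosure (fan a b J M) ↔ m = 0 := by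
  constructor
  · intro h
    have hentries : m = 0 ∨ m ≤ 0 := by
      simpa [coe_S_mul_T_zpow_mul_S_mul_T_zpow_mul_S, -Matrix.SpecialLinearGroup.coe_mul] using
        (signClosure_fan_subset h).imp And.left fun h' ↦ h'.2.2.1
    omega
  · rintro rfl
    have hS : S * S = -1 := by decide
    rwa [zpow_zero, mul_one, mul_assoc _ S, hS, mul_neg_one, neg_mem_signClosure,
      S_mul_T_zpow_mem_signClosure_fan_iff]

lemma outerSides_fan_subset (hJ : J ⊆ Set.Icc a b) :
    outerSides (fan a b J M) ⊆ fanArcs a b J M := by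
  rintro C ⟨_, ⟨i, hi, rfl⟩ | ⟨j, hj, m, hm, rfl⟩, e, he, rfl⟩
  · rcases e with _ | _ | _ <;> rw [Edge.crossing] at he
    · rw [S_mul_T_zpow_mul_T_mem_signClosure_fan_iff hi, not_ne_iff] at he
      exact Or.inl (Or.inl (Or.inl (by rw [he, Edge.arc])))
    · rw [S_mul_T_zpow_mul_T_inv_mem_signClosure_fan_iff hi, not_ne_iff] at he
      exact Or.inl (Or.inl (Or.inr (by rw [he, Edge.arc]; rfl)))
    · rw [S_mul_T_zpow_mul_S_mem_signClosure_fan_iff] at he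
      exact Or.inl (Or.inr ⟨i, hi, he, rfl⟩)
  · have hm' : (m : ℤ) ∈ Set.Icc 0 (M j : ℤ) := by simpa using hm
    refine Or.inr ⟨j, hj, ?_⟩
    rcases e with _ | _ | _ <;> rw [Edge.crossing, ← zpow_natCast] at he
    · rw [S_mul_T_zpow_mul_S_mul_T_zpow_mul_T_mem_signClosure_fan_iff hj hm', not_ne_iff,
        Nat.cast_inj] at he
      exact Or.inr (Or.inl (by rw [he, Edge.arc]))
    · rw [S_mul_T_zpow_mul_S_mul_T_zpow_mul_T_inv_mem_signClosure_fan_iff hj hm', not_ne_iff,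
        Nat.cast_eq_zero] at he
      exact Or.inl (by rw [he, pow_zero, mul_one, Edge.arc])
    · rw [S_mul_T_zpow_mul_S_mul_T_zpow_mul_S_mem_signClosure_fan_iff (hJ hj) hm'.1,
        Nat.cast_eq_zero] at he
      exact Or.inr (Or.inr ⟨m, Nat.one_le_iff_ne_zero.mpr he, hm, rfl⟩)

lemma fanArcs_subset_outerSides (hab : a ≤ b) (hJ : J ⊆ Set.Icc a b) :
    fanArcs a b J M ⊆ outerSides (fan a b J M) := by
  rintro C (((rfl | rfl) | ⟨i, hi, hiJ, rfl⟩) | ⟨j, hj, rfl | rfl | ⟨m, hm₁, hm, rfl⟩⟩)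
  · have hb := Set.right_mem_Icc.mpr hab
    refine ⟨_, S_mul_T_zpow_mem_fan hb, .left, ?_, rfl⟩
    rw [Edge.crossing, S_mul_T_zpow_mul_T_mem_signClosure_fan_iff hb, not_ne_iff]
  · have ha := Set.left_mem_Icc.mpr hab
    refine ⟨_, S_mul_T_zpow_mem_fan ha, .right, ?_, rfl⟩
    rw [Edge.crossing, S_mul_T_zpow_mul_T_inv_mem_signClosure_fan_iff ha, not_ne_iff]
  · refine ⟨_, S_mul_T_zpow_mem_fan hi, .base, ?_, rfl⟩
    rwa [Edge.crossing, S_mul_T_zpow_mul_S_mem_signClosure_fan_iff]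
  · have hm : (0 : ℤ) ∈ Set.Icc 0 (M j : ℤ) := by simp
    refine ⟨_, S_mul_T_zpow_mul_S_mul_T_zpow_mem_fan hj hm, .right, ?_,
      by rw [zpow_zero, mul_one, Edge.arc]⟩
    rw [Edge.crossing, S_mul_T_zpow_mul_S_mul_T_zpow_mul_T_inv_mem_signClosure_fan_iff hj hm,
      not_ne_iff]
  · have hm : (M j : ℤ) ∈ Set.Icc 0 (M j : ℤ) := by simp
    refine ⟨_, S_mul_T_zpow_mul_S_mul_T_zpow_mem_fan hj hm, .left, ?_,
      by rw [zpow_natCast, Edge.arc]⟩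
    rw [Edge.crossing, S_mul_T_zpow_mul_S_mul_T_zpow_mul_T_mem_signClosure_fan_iff hj hm,
      not_ne_iff]
  · have hm' : (m : ℤ) ∈ Set.Icc 0 (M j : ℤ) := by simpa using hm
    refine ⟨_, S_mul_T_zpow_mul_S_mul_T_zpow_mem_fan hj hm', .base, ?_,
      by rw [zpow_natCast, Edge.arc]⟩
    rw [Edge.crossing, S_mul_T_zpow_mul_S_mul_T_zpow_mul_S_mem_signClosure_fan_iff (hJ hj) hm'.1]
    omega

theorem outerSides_fan (hab : a ≤ b) (hJ : J ⊆ Set.Icc a b) :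
    outerSides (fan a b J M) = fanArcs a b J M :=
  (outerSides_fan_subset hJ).antisymm (fanArcs_subset_outerSides hab hJ)

end Fans

section Labels

lemma domain_eq_smul_fd (N : ℕ) : domain N = Θ N • fd := by
  rw [domain, Set.iUnion_smul_set]

lemma Θ_eq_fan (N : ℕ) :
    Θ N = fan (-N₁ N) (N₂ N) {j ∈ A N | 1 < Int.gcd j N} fun j ↦ M N j := by
  simp only [Θ, fan, A, Set.mem_ofPred_eq, and_assoc]

lemma listedArcs_eq_fanArcs {N : ℕ} (hN : 1 < N) :
    listedArcs N = fanArcs (-N₁ N) (N₂ N) {j ∈ A N | 1 < Int.gcd j N} fun j ↦ M N j := by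
  have hbase (i : ℤ) :
      (i ∈ A N ∧ Int.gcd i N = 1) ↔ i ∈ A N ∧ ¬(i ∈ A N ∧ 1 < Int.gcd i N) := by
    have : 0 < Int.gcd i N := Int.gcd_pos_of_ne_zero_right i (by omega)
    grind
  simp only [listedArcs, fanArcs, ← A.eq_def, ← and_assoc, hbase, Set.mem_ofPred_eq]

lemma neg_N₁_le_N₂ {N : ℕ} (hN : 1 < N) : -N₁ N ≤ N₂ N := by
  rw [N₁, N₂]
  omega

end Labels

end LabelArcs

open LabelArcs in
theorem proposition1p4_general {a b : ℤ} (hab : a ≤ b) {J : Set ℤ} (hJ : J ⊆ Set.Icc a b)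
    (M : ℤ → ℕ) :
    frontier (fan a b J M • ModularGroup.fd) = ⋃₀ fanArcs a b J M ∧
      {C | (∃ γ ∈ fan a b J M, C = γ • L ∨ C = γ • R ∨ C = γ • B) ∧
        C ⊆ frontier (fan a b J M • ModularGroup.fd)} = fanArcs a b J M := by
  rw [← outerSides_fan hab hJ]
  refine ⟨frontier_smul_fd _, ?_⟩
  rw [outerSides_eq]
  simp only [Edge.exists_iff, Edge.arc]

theorem proposition1p4 (N : ℕ) (hN : 1 < N) :
    frontier (LabelArcs.domain N) = ⋃₀ LabelArcs.listedArcs N ∧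
      LabelArcs.boundaryArcs N = LabelArcs.listedArcs N := by
  rw [LabelArcs.boundaryArcs, LabelArcs.sides, LabelArcs.domain_eq_smul_fd,
    LabelArcs.Θ_eq_fan, LabelArcs.listedArcs_eq_fanArcs hN]
  exact proposition1p4_general (LabelArcs.neg_N₁_le_N₂ hN) (fun _ hj ↦ hj.1) _
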